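/- Theorem 1.1 (Steinberg). Let $\mathbb{F}_q$ be a finite field with $q$ elements, $W$ an $n$-dimensional vector space over $\mathbb{F}_q$ and $m\geq 1$. Let ${\rm GL}(W)$ act diagonally on $mW=W\oplus\cdots\oplus W$ ($m$ copies), hence on the polynomial ring $\mathbb{F}_q[mW]=\mathbb{F}_q[x_{ij}\mid 1\le i\le m,\,1\le j\le n]$ and on its field of fractions $\mathbb{F}_q(mW)$, where $x_{ij}$ is the $j$-th coordinate function, with respect to a fixed basis of $W$, on the $i$-th summand. For $k\ge 0$ let $X_i^{q^k}$ be the column vector $(x_{i1}^{q^k},\dots,x_{in}^{q^k})^t$, and let $X_i=X_i^{q^0}$. Define the $n\times n$ matrix $$L_0=\begin{cases}(X_1,X_2,\dots,X_n), & m\ge n,\\ (X_1,\dots,X_{m-1},X_m^{q^{n-m}},X_m,X_m^{q},\dots,X_m^{q^{n-m-1}}), & m<n.\end{cases}$$ For $1\le i\le m$ and $1\le j\le n$ let $L_{ij}$ be the matrix obtained from $L_0$ by replacing its $j$-th column by the entrywise $q$-th power of the $i$-th column of $L_0$ if $i\le n$, and by $X_i$ if $i>n$. Put $\ell_0=\det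 L_0$ and $\ell_{ij}=\det L_{ij}$. Then $\ell_0\neq 0$, the $mn+1$ polynomials $\ell_0,\ell_{ij}$ are homogeneous and ${\rm SL}(W)$-invariant, and $$\mathbb{F}_q(mW)^{{\rm GL}(W)}=\mathbb{F}_q\left(\ell_{ij}/\ell_0\mid 1\le i\le m,\ 1\le j\le n\right).$$ -/

import Mathlib

namespace VectorInvariants

open MvPolynomial

noncomputable section

/-- `F[mW]`: the polynomial ring in the variables `x (i, j)`, where `x (i, j)` is the `j`-th
coordinate function (with respect to a basis of the `n`-dimensional space `W`) on the `i`-th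
summand of `mW`. -/
abbrev PolyRing (F : Type*) [Field F] (m n : ℕ) : Type _ := MvPolynomial (Fin m × Fin n) F

/-- `F(mW)`: the field of fractions of `F[mW]`. -/
abbrev RatField (F : Type*) [Field F] (m n : ℕ) : Type _ := FractionRing (PolyRing F m n)

section Action

variable {F : Type*} [Field F] {W : Type*} [AddCommGroup W] [Module F W] {n : ℕ}

/-- Diagonal action of `σ ∈ GL(W)` on `F[mW]`, i.e. `(σ f)(w) = f (σ⁻¹ w)`: the `j`-th coordinate
function `x (i, j)` on the `i`-th summand is sent to its composition with `σ⁻¹`. -/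
def polyActHom (b : Module.Basis (Fin n) F W) (m : ℕ) (σ : W ≃ₗ[F] W) :
    PolyRing F m n →ₐ[F] PolyRing F m n :=
  aeval fun p =>
    ∑ k : Fin n, C (LinearMap.toMatrix b b (σ⁻¹ : W ≃ₗ[F] W).toLinearMap p.2 k) * X (p.1, k)

theorem polyActHom_one (b : Module.Basis (Fin n) F W) (m : ℕ) :
    polyActHom b m (1 : W ≃ₗ[F] W) = AlgHom.id F (PolyRing F m n) := by
  apply MvPolynomial.algHom_ext
  rintro ⟨i, j⟩
  simp [polyActHom, Matrix.one_apply]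

theorem polyActHom_mul (b : Module.Basis (Fin n) F W) (m : ℕ) (σ τ : W ≃ₗ[F] W) :
    polyActHom b m (σ * τ) = (polyActHom b m σ).comp (polyActHom b m τ) := by
  apply MvPolynomial.algHom_ext
  rintro ⟨i, j⟩
  have h : (((σ * τ)⁻¹ : W ≃ₗ[F] W).toLinearMap)
      = (τ⁻¹ : W ≃ₗ[F] W).toLinearMap ∘ₗ (σ⁻¹ : W ≃ₗ[F] W).toLinearMap := by
    rw [mul_inv_rev]; rfl
  simp only [polyActHom, h, LinearMap.toMatrix_comp b b b, Matrix.mul_apply, aeval_X,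
    AlgHom.comp_apply, map_sum, map_mul, algHom_C, algebraMap_eq, Finset.sum_mul, Finset.mul_sum]
  rw [Finset.sum_comm]
  simp only [mul_assoc]

/-- The diagonal action of `GL(W)` on `F[mW]` by `F`-algebra automorphisms. -/
def polyAct (b : Module.Basis (Fin n) F W) (m : ℕ) :
    (W ≃ₗ[F] W) →* (PolyRing F m n ≃ₐ[F] PolyRing F m n) where
  toFun σ := AlgEquiv.ofAlgHom (polyActHom b m σ) (polyActHom b m σ⁻¹)
    (by rw [← polyActHom_mul, mul_inv_cancel, polyActHom_one])
    (by rw [← polyActHom_mul, inv_mul_cancel, polyActHom_one])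
  map_one' := by
    ext1 x
    exact DFunLike.congr_fun (polyActHom_one b m) x
  map_mul' σ τ := by
    ext1 x
    exact DFunLike.congr_fun (polyActHom_mul b m σ τ) x

/-- The induced action of `GL(W)` on `F(mW)` by field automorphisms over `F`. -/
def ratAct (b : Module.Basis (Fin n) F W) (m : ℕ) :
    (W ≃ₗ[F] W) →* (RatField F m n ≃ₐ[F] RatField F m n) :=
  (IsFractionRing.fieldEquivOfAlgEquivHom F (RatField F m n)).comp (polyAct b m)

/-- The invariant ring `F[mW]^G` of a subgroup `G ≤ GL(W)`. -/
def invariantRing (b : Module.Basis (Fin n) F W) (m : ℕ) (G : Subgroup (W ≃ₗ[F] W)) :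
    Subalgebra F (PolyRing F m n) where
  carrier := {f | ∀ σ ∈ G, polyAct b m σ f = f}
  mul_mem' hf hg σ hσ := by rw [map_mul, hf σ hσ, hg σ hσ]
  add_mem' hf hg σ hσ := by rw [map_add, hf σ hσ, hg σ hσ]
  algebraMap_mem' r σ _ := (polyAct b m σ).commutes r

/-- The invariant field `F(mW)^G` of a subgroup `G ≤ GL(W)`. -/
def invariantField (b : Module.Basis (Fin n) F W) (m : ℕ) (G : Subgroup (W ≃ₗ[F] W)) :
    IntermediateField F (RatField F m n) :=
  IntermediateField.fixedField (G.map (ratAct b m))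

/-- `SL(W)`, as a subgroup of `GL(W)`. -/
def specialLinear (F W : Type*) [Field F] [AddCommGroup W] [Module F W] :
    Subgroup (W ≃ₗ[F] W) :=
  (LinearEquiv.det : (W ≃ₗ[F] W) →* Fˣ).ker

end Action

section Steinberg

variable (F : Type*) [Field F] [Fintype F] {m : ℕ} (n : ℕ)

/-- The column vector `X_i ^ (q ^ e)`, with entries `x (i, j) ^ (q ^ e)` and `q = |F|`. -/
def vecPow (i : Fin m) (e : ℕ) : Fin n → PolyRing F m n :=
  fun j => X (i, j) ^ (Fintype.card F ^ e)

/-- The columns of the `n × n` matrix `L₀`. With the vectors and the columns numbered from `1`: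
if `m ≥ n`, the columns are `X_1, …, X_n`; if `m < n`, they are
`X_1, …, X_{m-1}, X_m ^ (q ^ (n-m)), X_m, X_m ^ q, …, X_m ^ (q ^ (n-m-1))`.
In the code, vectors and columns are numbered from `0`. -/
def colL0 (hm : 0 < m) (k : Fin n) : Fin n → PolyRing F m n :=
  if h : n ≤ m then vecPow F n ⟨k, k.2.trans_le h⟩ 0
  else if h : (k : ℕ) + 1 < m then vecPow F n ⟨k, (Nat.lt_succ_self _).trans h⟩ 0
  else if (k : ℕ) + 1 = m then vecPow F n ⟨m - 1, Nat.sub_lt hm Nat.one_pos⟩ (n - m)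
  else vecPow F n ⟨m - 1, Nat.sub_lt hm Nat.one_pos⟩ (k - m)

/-- The matrix `L₀`. -/
def matL0 (hm : 0 < m) : Matrix (Fin n) (Fin n) (PolyRing F m n) :=
  Matrix.of fun r k => colL0 F n hm k r

/-- The matrix `L_ij`: the `j`-th column of `L₀` is replaced by the `q`-th power of the `i`-th
column of `L₀` if `i ≤ n`, and by `X_i` if `n < i ≤ m` (numbering from `1`). -/
def matL (hm : 0 < m) (i : Fin m) (j : Fin n) : Matrix (Fin n) (Fin n) (PolyRing F m n) :=
  (matL0 F n hm).updateCol j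
    (if h : (i : ℕ) < n then fun r => matL0 F n hm r ⟨i, h⟩ ^ Fintype.card F
     else vecPow F n i 0)

/-- `ℓ₀ = det L₀`. -/
def ell0 (hm : 0 < m) : PolyRing F m n := (matL0 F n hm).det

/-- `ℓ_ij = det L_ij`. -/
def ell (hm : 0 < m) (i : Fin m) (j : Fin n) : PolyRing F m n := (matL F n hm i j).det

end Steinberg

end

end VectorInvariants

namespace VectorInvariants

open MvPolynomial

/-! Let `K` be generated by the quotients, `E = F(mW)` and `B = L₀`. Every matrix involved has
columns of the form `X_a ^ (q ^ e)`, on which `GL(W)` acts by left multiplication by a matrix over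
`F`; so all the determinants scale by the same factor and the quotients are invariant. Conversely,
Cramer's rule gives `B^(q) = B A` with `A` over `K`, and makes each `X_i` a `K`-combination of the
columns of `B`. Hence the entries of `B` generate `E` over `K`. A `K`-derivation kills `q`-th
powers, hence kills `B`, so `E / K` is separable (`isSeparable_of_frobenius_eq_mul`). Two
`K`-embeddings of `E` send `B` to solutions of the same system, which differ by a Frobenius-fixed
matrix, that is, by an element of `GL_n(F)`; thus all embeddings come from `GL(W)`
(`exists_ratAct_eq`). An invariant has the same image under all of them, so by separability it lies
in `K`. -/

theorem derivation_eq_zero_of_adjoin_eq_top {K E M : Type*} [Field K] [Field E] [Algebra K E]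
    [AddCommGroup M] [Module E M] [Module K M] [IsScalarTower K E M]
    (D : Derivation K E M) {S : Set E} (hS : IntermediateField.adjoin K S = ⊤)
    (h : ∀ x ∈ S, D x = 0) : D = 0 := by
  ext x
  have hx : x ∈ IntermediateField.adjoin K S := hS ▸ IntermediateField.mem_top
  induction hx using IntermediateField.adjoin_induction with
  | mem x hx => exact h x hx
  | algebraMap x => simp
  | add x y _ _ hx hy => simp_all
  | inv x _ hx => simp_all [Derivation.leibniz_inv]
  | mul x y _ _ hx hy => simp_all

/-- `X^q - X` is the product of the `X - a` with `a` in `F`, so it has no further roots in `E`. -/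
theorem exists_algebraMap_eq_of_pow_card {F : Type*} [Field F] [Fintype F] {E : Type*} [Field E]
    [Algebra F E] {x : E} (hx : x ^ Fintype.card F = x) : ∃ a : F, algebraMap F E a = x := by
  have hm : (Polynomial.X ^ Fintype.card F - Polynomial.X : Polynomial F).Monic :=
    Polynomial.monic_X_pow_sub (by simpa using Fintype.one_lt_card (α := F))
  have h := Polynomial.prod_multiset_X_sub_C_of_monic_of_roots_card_eq hm (by
    rw [FiniteField.roots_X_pow_card_sub_X,
      FiniteField.X_pow_card_sub_X_natDegree_eq F Fintype.one_lt_card]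
    rfl)
  rw [FiniteField.roots_X_pow_card_sub_X] at h
  have h2 := congrArg (Polynomial.aeval x) h
  simp only [map_sub, map_pow, Polynomial.aeval_X, hx, sub_self] at h2
  change Polynomial.aeval x (∏ a : F, (Polynomial.X - Polynomial.C a)) = 0 at h2
  simp only [map_prod, map_sub, Polynomial.aeval_X, Polynomial.aeval_C,
    Finset.prod_eq_zero_iff] at h2
  obtain ⟨a, -, ha⟩ := h2
  exact ⟨a, (sub_eq_zero.mp ha).symm⟩

/-! ### Frobenius systems `B^(q) = B A`: separability and embeddings -/

section Frobenius

variable {F : Type*} [Field F] [Fintype F] {K E : Type*} [Field K] [Field E]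
  [Algebra F E] [Algebra K E] {ι : Type*} [Fintype ι] [DecidableEq ι]

theorem det_ne_zero_of_frobenius_eq_mul {B : Matrix ι ι E} {A : Matrix ι ι K} (hB : B.det ≠ 0)
    (h : B.map (FiniteField.frobeniusAlgHom F E) = B * A.map (algebraMap K E)) : A.det ≠ 0 := by
  intro hA
  have h1 := congrArg Matrix.det h
  have h2 : (A.map (algebraMap K E)).det = algebraMap K E A.det :=
    (RingHom.map_det (algebraMap K E) A).symm
  have h3 : (B.map (FiniteField.frobeniusAlgHom F E)).det = FiniteField.frobeniusAlgHom F E B.det :=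
    (AlgHom.map_det (FiniteField.frobeniusAlgHom F E) B).symm
  rw [Matrix.det_mul, h2, h3, hA, map_zero, mul_zero] at h1
  exact hB ((map_eq_zero _).mp h1)

/-- A derivation kills the entries of an invertible solution of `B^(q) = B A`. -/
theorem derivation_eq_zero_of_frobenius_eq_mul {M : Type*} [AddCommGroup M] [Module E M]
    [Module K M] [IsScalarTower K E M] (D : Derivation K E M)
    {B : Matrix ι ι E} {A : Matrix ι ι K} (hB : B.det ≠ 0)
    (h : B.map (FiniteField.frobeniusAlgHom F E) = B * A.map (algebraMap K E)) (r k : ι) :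
    D (B r k) = 0 := by
  have hq : (Fintype.card F : E) = 0 := by
    rw [← map_natCast (algebraMap F E), FiniteField.cast_card_eq_zero, map_zero]
  -- Differentiate the system: the left side gives `0` because `q = 0` in `E`, and the entries of
  -- `A` are constants.
  have hsum : ∀ j, ∑ l, A l j • D (B r l) = 0 := by
    intro j
    have h1 := congrArg D (congrFun (congrFun h r) j)
    rw [Matrix.map_apply, FiniteField.coe_frobeniusAlgHom, Derivation.leibniz_pow,
      ← Nat.cast_smul_eq_nsmul E, hq, zero_smul, Matrix.mul_apply, map_sum] at h1
    rw [h1]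
    refine Finset.sum_congr rfl fun l _ => ?_
    simp [Derivation.leibniz]
  have hA : IsUnit A.det := (det_ne_zero_of_frobenius_eq_mul hB h).isUnit
  calc D (B r k) = ∑ l, (A * A⁻¹) l k • D (B r l) := by
        simp [Matrix.mul_nonsing_inv A hA, Matrix.one_apply, ite_smul]
    _ = ∑ j, A⁻¹ j k • ∑ l, A l j • D (B r l) := by
        simp only [Matrix.mul_apply, Finset.sum_smul, Finset.smul_sum, smul_smul]
        rw [Finset.sum_comm]
        simp only [mul_comm]
    _ = 0 := by simp [hsum]

/-- The universal derivation kills the generators, so there are no Kähler differentials; an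
essentially finite unramified field extension is separable algebraic. -/
theorem isSeparable_of_frobenius_eq_mul {K E : Type*} [Field K] [Field E]
    [Algebra F E] [Algebra K E] [Algebra.EssFiniteType K E]
    {B : Matrix ι ι E} {A : Matrix ι ι K} (hB : B.det ≠ 0)
    (h : B.map (FiniteField.frobeniusAlgHom F E) = B * A.map (algebraMap K E))
    (hgen : IntermediateField.adjoin K (Set.range fun p : ι × ι => B p.1 p.2) = ⊤) :
    Algebra.IsSeparable K E := by
  have : Algebra.FormallyUnramified K E := by
    constructor
    have hD : KaehlerDifferential.D K E = 0 :=
      derivation_eq_zero_of_adjoin_eq_top _ hgen (by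
        rintro _ ⟨p, rfl⟩
        exact derivation_eq_zero_of_frobenius_eq_mul _ hB h _ _)
    have hs := KaehlerDifferential.span_range_derivation K E
    rw [hD] at hs
    rw [← Submodule.subsingleton_iff E, ← subsingleton_iff_bot_eq_top, ← hs, eq_comm,
      Submodule.span_eq_bot]
    rintro _ ⟨x, rfl⟩
    rfl
  exact Algebra.FormallyUnramified.isSeparable K E

/-- Embeddings over `K` act on a solution of `B^(q) = B A` by left multiplication by a matrix
over `F`. -/
theorem exists_map_eq_mul_of_frobenius_eq_mul {Ω : Type*} [Field Ω] [Algebra F Ω] [Algebra K Ω]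
    {B : Matrix ι ι E} {A : Matrix ι ι K} (hB : B.det ≠ 0)
    (h : B.map (FiniteField.frobeniusAlgHom F E) = B * A.map (algebraMap K E))
    (σ τ : E →ₐ[K] Ω) :
    ∃ G : Matrix ι ι F, G.det ≠ 0 ∧ B.map τ = G.map (algebraMap F Ω) * B.map σ := by
  have hA := det_ne_zero_of_frobenius_eq_mul hB h
  have key : ∀ ρ : E →ₐ[K] Ω, (B.map ρ).map (FiniteField.frobeniusAlgHom F Ω) =
      B.map ρ * A.map (algebraMap K Ω) := by
    intro ρ
    have h1 := congrArg (fun M : Matrix ι ι E => M.map ρ) h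
    simp only [Matrix.map_mul] at h1
    rw [Matrix.map_map] at h1 ⊢
    convert h1 using 2
    · ext x; simp
    · ext x; simp
  have hdet : ∀ ρ : E →ₐ[K] Ω, (B.map ρ).det ≠ 0 := fun ρ => by
    have := (AlgHom.map_det ρ B)
    rw [AlgHom.mapMatrix_apply] at this
    rw [← this]
    exact (map_ne_zero ρ).mpr hB
  set T := B.map τ
  set S := B.map σ
  set A' := A.map (algebraMap K Ω)
  have hS : IsUnit S.det := (hdet σ).isUnit
  have hT := key τ
  have hS' := key σ
  have hA' : A'.det ≠ 0 := by
    have := RingHom.map_det (algebraMap K Ω) A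
    rw [RingHom.mapMatrix_apply] at this
    rw [← this]
    exact (map_ne_zero _).mpr hA
  set G := T * S⁻¹
  have hG : B.map τ = G * B.map σ := by
    change T = G * S
    rw [Matrix.mul_assoc, Matrix.nonsing_inv_mul S hS, Matrix.mul_one]
  -- With `S = σ(B)`, applying Frobenius to `τ(B) = G S` gives `G^(q) S A' = G S A'`, and `S A'`
  -- cancels.
  have hGfrob : G.map (FiniteField.frobeniusAlgHom F Ω) = G := by
    have h1 := congrArg (fun M : Matrix ι ι Ω => M.map (FiniteField.frobeniusAlgHom F Ω)) hG
    simp only [Matrix.map_mul] at h1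
    rw [hT, hS', hG, Matrix.mul_assoc G] at h1
    have hu : IsUnit (B.map σ * A') := by
      rw [Matrix.isUnit_iff_isUnit_det, Matrix.det_mul]
      exact (mul_ne_zero (hdet σ) hA').isUnit
    exact (hu.mul_right_cancel h1).symm
  choose g hg using fun r k => exists_algebraMap_eq_of_pow_card (F := F)
    (x := G r k) (congrFun (congrFun hGfrob r) k)
  have hGg : (Matrix.of g).map (algebraMap F Ω) = G := by
    ext r k; exact hg r k
  refine ⟨Matrix.of g, fun h0 => ?_, by rw [hGg]; exact hG⟩
  have h2 := RingHom.map_det (algebraMap F Ω) (Matrix.of g)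
  rw [RingHom.mapMatrix_apply, hGg, h0, map_zero] at h2
  apply hdet τ
  rw [hG, Matrix.det_mul, ← h2, zero_mul]

end Frobenius

/-- The images of `x` under the embeddings are all the roots of its minimal polynomial. These are
simple, so a single image forces degree one. -/
theorem mem_range_algebraMap_of_algHom_eq {K E : Type*} (Ω : Type*) [Field K] [Field E] [Field Ω]
    [Algebra K E] [Algebra K Ω] [IsAlgClosed Ω] [Algebra.IsSeparable K E] (σ : E →ₐ[K] Ω) {x : E}
    (h : ∀ τ : E →ₐ[K] Ω, τ x = σ x) : x ∈ (algebraMap K E).range := by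
  rw [← minpoly.natDegree_eq_one_iff,
    ← Polynomial.card_rootSet_eq_natDegree (K := Ω) (Algebra.IsSeparable.isSeparable K x)
      (IsAlgClosed.splits _), Fintype.card_eq_one_iff]
  have hr := Algebra.IsAlgebraic.range_eval_eq_rootSet_minpoly (F := K) (K := E) Ω x
  refine ⟨⟨σ x, hr ▸ ⟨σ, rfl⟩⟩, fun ⟨y, hy⟩ => Subtype.ext ?_⟩
  rw [← hr] at hy
  obtain ⟨τ, rfl⟩ := hy
  exact h τ

theorem sum_smul_pow_card_pow {F : Type*} [Field F] [Fintype F] {R : Type*} [CommRing R]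
    [Algebra F R] {ι : Type*} (s : Finset ι) (a : ι → F) (x : ι → R) (e : ℕ) :
    (∑ l ∈ s, a l • x l) ^ Fintype.card F ^ e = ∑ l ∈ s, a l • x l ^ Fintype.card F ^ e := by
  induction e with
  | zero => simp
  | succ e ih =>
    simp only [pow_succ, pow_mul, ih]
    have h := map_sum (FiniteField.frobeniusAlgHom F R)
      (fun l => a l • x l ^ Fintype.card F ^ e) s
    simpa only [map_smul, FiniteField.coe_frobeniusAlgHom] using h

/-! ### Determinants with columns `X_a ^ (q ^ e)` -/

section Matrices

variable {F : Type*} [Field F] [Fintype F] {m n : ℕ}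

/-- The matrix with columns `X_{a k} ^ (q ^ e k)`. -/
noncomputable def powMatrix (F : Type*) [Field F] [Fintype F] {m n : ℕ} (a : Fin n → Fin m)
    (e : Fin n → ℕ) : Matrix (Fin n) (Fin n) (PolyRing F m n) :=
  Matrix.of fun r k => vecPow F n (a k) (e k) r

theorem det_powMatrix_isHomogeneous (a : Fin n → Fin m) (e : Fin n → ℕ) :
    (powMatrix F a e).det.IsHomogeneous (∑ k, Fintype.card F ^ e k) := by
  rw [Matrix.det_apply']
  refine IsHomogeneous.sum _ _ _ fun σ _ => ?_
  rw [← zero_add (∑ k, _)]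
  refine IsHomogeneous.mul ?_ (IsHomogeneous.prod _ _ _ fun k _ => ?_)
  · have : ((Equiv.Perm.sign σ : ℤ) : PolyRing F m n) = C ((Equiv.Perm.sign σ : ℤ) : F) := by simp
    rw [this]
    exact isHomogeneous_C _ _
  · simpa [powMatrix, vecPow] using (isHomogeneous_X F (a k, σ k)).pow (Fintype.card F ^ e k)

/-- Coefficients in `F` are fixed by Frobenius, so the same matrix acts whatever the exponent. -/
theorem polyAct_vecPow {W : Type*} [AddCommGroup W] [Module F W] (b : Module.Basis (Fin n) F W)
    (σ : W ≃ₗ[F] W) (i : Fin m) (e : ℕ) (r : Fin n) :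
    polyAct b m σ (vecPow F n i e r) =
      ∑ l, C (LinearMap.toMatrix b b (σ⁻¹ : W ≃ₗ[F] W).toLinearMap r l) * vecPow F n i e l := by
  have h : polyAct b m σ (X (i, r)) =
      ∑ l, LinearMap.toMatrix b b (σ⁻¹ : W ≃ₗ[F] W).toLinearMap r l • X (i, l) := by
    change polyActHom b m σ (X (i, r)) = _
    simp [polyActHom, smul_eq_C_mul]
  simp only [vecPow, map_pow, h, sum_smul_pow_card_pow]
  simp only [smul_eq_C_mul]

theorem polyAct_det_powMatrix {W : Type*} [AddCommGroup W] [Module F W]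
    (b : Module.Basis (Fin n) F W) (σ : W ≃ₗ[F] W) (a : Fin n → Fin m) (e : Fin n → ℕ) :
    polyAct b m σ (powMatrix F a e).det =
      C (LinearMap.det (σ⁻¹ : W ≃ₗ[F] W).toLinearMap) * (powMatrix F a e).det := by
  have h : (powMatrix F a e).map (polyAct b m σ) =
      (LinearMap.toMatrix b b (σ⁻¹ : W ≃ₗ[F] W).toLinearMap).map C * powMatrix F a e := by
    ext1 r k
    simp [powMatrix, polyAct_vecPow, Matrix.mul_apply]
  have h1 := AlgEquiv.map_det (polyAct b m σ) (powMatrix F a e)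
  rw [AlgEquiv.mapMatrix_apply, h, Matrix.det_mul] at h1
  rw [h1, ← LinearMap.det_toMatrix b, RingHom.map_det C, RingHom.mapMatrix_apply]

theorem det_powMatrix_mem_invariantRing {W : Type*} [AddCommGroup W] [Module F W]
    (b : Module.Basis (Fin n) F W) (a : Fin n → Fin m) (e : Fin n → ℕ) :
    (powMatrix F a e).det ∈ invariantRing b m (specialLinear F W) := by
  intro σ hσ
  have h1 : LinearEquiv.det σ⁻¹ = 1 := by
    rw [map_inv, (MonoidHom.mem_ker.mp hσ : LinearEquiv.det σ = 1), inv_one]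
  have h2 : LinearMap.det (σ⁻¹ : W ≃ₗ[F] W).toLinearMap = 1 := by
    rw [← LinearEquiv.coe_det, h1, Units.val_one]
  rw [polyAct_det_powMatrix, h2, C_1, one_mul]

/-- Specializing `x (i, j)` to `t_i ^ j`, with `j` counted from `0`, yields a transposed Vandermonde
matrix whose nodes `t_{a k} ^ (q ^ e k)` are distinct monomials. -/
theorem det_powMatrix_ne_zero {a : Fin n → Fin m} {e : Fin n → ℕ}
    (h : Function.Injective fun k => (a k, e k)) : (powMatrix F a e).det ≠ 0 := by
  let φ : PolyRing F m n →ₐ[F] MvPolynomial (Fin m) F := aeval fun p => X p.1 ^ (p.2 : ℕ)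
  intro h0
  have h1 := AlgHom.map_det φ (powMatrix F a e)
  have h2 : φ.mapMatrix (powMatrix F a e) =
      (Matrix.vandermonde fun k =>
        (X (a k) : MvPolynomial (Fin m) F) ^ Fintype.card F ^ e k).transpose := by
    ext1 r k
    simp [powMatrix, vecPow, φ, Matrix.vandermonde_apply, ← pow_mul, mul_comm]
  rw [h0, map_zero, h2, Matrix.det_transpose] at h1
  refine Matrix.det_vandermonde_ne_zero_iff.mpr (fun k l hkl => h ?_) h1.symm
  simp only [X_pow_eq_monomial] at hkl
  have h3 := (monomial_left_inj (one_ne_zero : (1 : F) ≠ 0)).mp hkl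
  have hq : ∀ e, Fintype.card F ^ e ≠ 0 := fun e => pow_ne_zero _ Fintype.card_ne_zero
  rcases (Finsupp.single_eq_single_iff _ _ _ _).mp h3 with ⟨h4, h5⟩ | ⟨h4, -⟩
  · exact Prod.ext h4 (Nat.pow_right_injective Fintype.one_lt_card h5)
  · exact absurd h4 (hq _)

/-- The index of the vector in the `k`-th column of `L₀`. -/
def colIndex (hm : 0 < m) (k : Fin n) : Fin m :=
  if h : n ≤ m then ⟨k, k.2.trans_le h⟩
  else if h : (k : ℕ) + 1 < m then ⟨k, (Nat.lt_succ_self _).trans h⟩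
  else ⟨m - 1, Nat.sub_lt hm Nat.one_pos⟩

/-- The Frobenius exponent in the `k`-th column of `L₀`. -/
def colExp (m : ℕ) (k : Fin n) : ℕ :=
  if n ≤ m then 0
  else if (k : ℕ) + 1 < m then 0
  else if (k : ℕ) + 1 = m then n - m
  else k - m

theorem colL0_eq_vecPow (hm : 0 < m) (k : Fin n) :
    colL0 F n hm k = vecPow F n (colIndex hm k) (colExp m k) := by
  unfold colL0 colIndex colExp
  split_ifs <;> rfl

theorem colIndex_colExp_injective (hm : 0 < m) :
    Function.Injective fun k : Fin n => (colIndex hm k, colExp m k) := by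
  intro k l hkl
  obtain ⟨h1, h2⟩ := Prod.mk.inj hkl
  have h1 := congrArg Fin.val h1
  have hk := k.2
  have hl := l.2
  unfold colIndex at h1
  unfold colExp at h2
  apply Fin.ext
  split_ifs at h1 h2 <;> simp at h1 h2 <;> omega

theorem matL0_eq_powMatrix (hm : 0 < m) :
    matL0 F n hm = powMatrix F (colIndex hm) (colExp m) := by
  ext1 r k
  simp [matL0, powMatrix, colL0_eq_vecPow]

/-- The column by which a column of `L₀` is replaced in `L_ij`. -/
noncomputable def replCol (F : Type*) [Field F] [Fintype F] (n : ℕ) {m : ℕ} (hm : 0 < m)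
    (i : Fin m) : Fin n → PolyRing F m n :=
  if h : (i : ℕ) < n then fun r => matL0 F n hm r ⟨i, h⟩ ^ Fintype.card F
  else vecPow F n i 0

theorem ell_eq_cramer (hm : 0 < m) (i : Fin m) (j : Fin n) :
    ell F n hm i j = (matL0 F n hm).cramer (replCol F n hm i) j := by
  rw [Matrix.cramer_apply]
  rfl

theorem exists_replCol_eq_vecPow (hm : 0 < m) (i : Fin m) :
    ∃ a e, replCol F n hm i = vecPow F n a e := by
  unfold replCol
  split_ifs with h
  · refine ⟨colIndex hm ⟨i, h⟩, colExp m (⟨i, h⟩ : Fin n) + 1, ?_⟩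
    ext1 r
    simp [matL0_eq_powMatrix, powMatrix, vecPow, pow_succ, pow_mul]
  · exact ⟨i, 0, rfl⟩

theorem exists_matL_eq_powMatrix (hm : 0 < m) (i : Fin m) (j : Fin n) :
    ∃ a e, matL F n hm i j = powMatrix F a e := by
  obtain ⟨a, e, h⟩ := exists_replCol_eq_vecPow (F := F) (n := n) hm i
  refine ⟨Function.update (colIndex hm) j a, Function.update (colExp m) j e, ?_⟩
  have h1 : matL F n hm i j = (matL0 F n hm).updateCol j (replCol F n hm i) := rfl
  rw [h1, h, matL0_eq_powMatrix]
  ext1 r k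
  by_cases hk : k = j
  · subst hk; simp [powMatrix]
  · simp [powMatrix, hk]

theorem ell0_ne_zero (hm : 0 < m) : ell0 F n hm ≠ 0 := by
  rw [ell0, matL0_eq_powMatrix]
  exact det_powMatrix_ne_zero (colIndex_colExp_injective hm)

end Matrices

/-! ### The field generated by the quotients -/

section Generation

variable {F : Type*} [Field F] [Fintype F] {m n : ℕ}

/-- This explains the column order of `L₀` for `m < n`: the first `m` columns have their Frobenius
images supplied by the replacement columns, and each remaining column is sent to another column of
`L₀`. -/
theorem frobenius_column_cases (hm : 0 < m) (k : Fin n) :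
    (∃ i, replCol F n hm i = vecPow F n (colIndex hm k) (colExp m k + 1)) ∨
      ∃ l : Fin n, colIndex hm l = colIndex hm k ∧ colExp m l = colExp m k + 1 := by
  have hk := k.2
  by_cases hkm : (k : ℕ) < m
  · refine Or.inl ⟨⟨k, hkm⟩, ?_⟩
    ext1 r
    simp [replCol, matL0_eq_powMatrix, powMatrix, vecPow, pow_succ, pow_mul]
  · right
    have hnm : ¬ n ≤ m := by omega
    by_cases hkn : (k : ℕ) + 1 < n
    · obtain ⟨l, hl⟩ : ∃ l : Fin n, (l : ℕ) = k + 1 := ⟨⟨k + 1, hkn⟩, rfl⟩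
      refine ⟨l, ?_, ?_⟩
      · unfold colIndex
        apply Fin.ext
        split_ifs <;> (try dsimp only at *) <;> omega
      · unfold colExp
        split_ifs <;> omega
    -- The last column has exponent `n - 1 - m`; the next power sits in column `m - 1`.
    · refine ⟨⟨m - 1, by omega⟩, ?_, ?_⟩
      · unfold colIndex
        apply Fin.ext
        split_ifs <;> (try dsimp only at *) <;> omega
      · unfold colExp
        split_ifs <;> (try dsimp only at *) <;> omega

theorem vector_column_cases (hm : 0 < m) (i : Fin m) :
    replCol F n hm i = vecPow F n i 0 ∨
      ∃ l : Fin n, colIndex hm l = i ∧ colExp m l = 0 := by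
  have hi := i.2
  by_cases hin : (i : ℕ) < n
  · right
    by_cases h : n ≤ m ∨ (i : ℕ) + 1 < m
    · refine ⟨⟨i, hin⟩, ?_, ?_⟩
      · unfold colIndex
        apply Fin.ext
        split_ifs <;> dsimp only at * <;> omega
      · unfold colExp
        split_ifs <;> (try dsimp only at *) <;> omega
    -- Here `m < n` and `i = m - 1`: column `m - 1` holds a higher power, and the vector itself is
    -- column `m`.
    · obtain ⟨l, hl⟩ : ∃ l : Fin n, (l : ℕ) = m := ⟨⟨m, by omega⟩, rfl⟩
      refine ⟨l, ?_, ?_⟩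
      · unfold colIndex
        apply Fin.ext
        split_ifs <;> (try dsimp only at *) <;> omega
      · unfold colExp
        split_ifs <;> (try dsimp only at *) <;> omega
  · left
    simp [replCol, hin]

/-- The field generated by the quotients `ℓ_ij / ℓ₀`. -/
noncomputable def quotientField (F : Type*) [Field F] [Fintype F] {m : ℕ} (n : ℕ) (hm : 0 < m) :
    IntermediateField F (RatField F m n) :=
  IntermediateField.adjoin F (Set.range fun p : Fin m × Fin n =>
    algebraMap (PolyRing F m n) (RatField F m n) (ell F n hm p.1 p.2) /
      algebraMap (PolyRing F m n) (RatField F m n) (ell0 F n hm))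

/-- The matrix `L₀` over the field of fractions. -/
noncomputable def ratMatL0 (F : Type*) [Field F] [Fintype F] {m : ℕ} (n : ℕ) (hm : 0 < m) :
    Matrix (Fin n) (Fin n) (RatField F m n) :=
  (matL0 F n hm).map (algebraMap (PolyRing F m n) (RatField F m n))

theorem det_ratMatL0 (hm : 0 < m) :
    (ratMatL0 F n hm).det = algebraMap (PolyRing F m n) (RatField F m n) (ell0 F n hm) :=
  (RingHom.map_det _ _).symm

theorem det_ratMatL0_ne_zero (hm : 0 < m) : (ratMatL0 F n hm).det ≠ 0 := by
  rw [det_ratMatL0]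
  simpa using ell0_ne_zero (F := F) (n := n) hm

/-- Cramer's rule: the coefficients are the generators `ℓ_ij / ℓ₀` themselves. -/
theorem exists_replCol_eq_sum (hm : 0 < m) (i : Fin m) :
    ∃ c : Fin n → quotientField F n hm, ∀ r,
      algebraMap (PolyRing F m n) (RatField F m n) (replCol F n hm i r) =
        ∑ l, ratMatL0 F n hm r l * (c l : RatField F m n) := by
  refine ⟨fun l => ⟨_, IntermediateField.subset_adjoin F _ ⟨(i, l), rfl⟩⟩, fun r => ?_⟩
  have h := congrFun ((matL0 F n hm).mulVec_cramer (replCol F n hm i)) r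
  have h0 := det_ratMatL0_ne_zero (F := F) (n := n) hm
  rw [det_ratMatL0] at h0
  have h1 := congrArg (algebraMap (PolyRing F m n) (RatField F m n)) h
  simp only [Matrix.mulVec, dotProduct, map_sum, map_mul, Pi.smul_apply, smul_eq_mul,
    ← ell_eq_cramer] at h1
  simp only [mul_div_assoc', ← Finset.sum_div]
  rw [eq_div_iff h0, mul_comm]
  exact h1.symm

theorem exists_column_eq_sum (hm : 0 < m) (k : Fin n) :
    ∃ c : Fin n → quotientField F n hm, ∀ r,
      algebraMap (PolyRing F m n) (RatField F m n) (vecPow F n (colIndex hm k) (colExp m k) r) =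
        ∑ l, ratMatL0 F n hm r l * (c l : RatField F m n) := by
  refine ⟨Pi.single k 1, fun r => ?_⟩
  rw [Finset.sum_eq_single k (fun l _ hl => by simp [hl]) (by simp)]
  simp [ratMatL0, matL0_eq_powMatrix, powMatrix]

theorem exists_frobenius_column_eq_sum (hm : 0 < m) (k : Fin n) :
    ∃ c : Fin n → quotientField F n hm, ∀ r,
      ratMatL0 F n hm r k ^ Fintype.card F =
        ∑ l, ratMatL0 F n hm r l * (c l : RatField F m n) := by
  have h : ∀ r, ratMatL0 F n hm r k ^ Fintype.card F =
      algebraMap (PolyRing F m n) (RatField F m n)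
        (vecPow F n (colIndex hm k) (colExp m k + 1) r) := fun r => by
    simp [ratMatL0, matL0_eq_powMatrix, powMatrix, vecPow, pow_succ, pow_mul]
  simp only [h]
  rcases frobenius_column_cases (F := F) hm k with ⟨i, hi⟩ | ⟨l, h1, h2⟩
  · rw [← hi]
    exact exists_replCol_eq_sum hm i
  · rw [← h1, ← h2]
    exact exists_column_eq_sum hm l

theorem exists_X_eq_sum (hm : 0 < m) (i : Fin m) :
    ∃ c : Fin n → quotientField F n hm, ∀ r,
      algebraMap (PolyRing F m n) (RatField F m n) (X (i, r)) =
        ∑ l, ratMatL0 F n hm r l * (c l : RatField F m n) := by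
  have h : ∀ r, (X (i, r) : PolyRing F m n) = vecPow F n i 0 r := fun r => by simp [vecPow]
  simp only [h]
  rcases vector_column_cases (F := F) (n := n) hm i with hi | ⟨l, h1, h2⟩
  · rw [← hi]
    exact exists_replCol_eq_sum hm i
  · rw [← h1, ← h2]
    exact exists_column_eq_sum hm l

theorem exists_frobenius_ratMatL0_eq_mul (hm : 0 < m) :
    ∃ A : Matrix (Fin n) (Fin n) (quotientField F n hm),
      (ratMatL0 F n hm).map (FiniteField.frobeniusAlgHom F (RatField F m n)) =
        ratMatL0 F n hm * A.map (algebraMap (quotientField F n hm) (RatField F m n)) := by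
  choose c hc using exists_frobenius_column_eq_sum (F := F) (n := n) hm
  refine ⟨Matrix.of fun l k => c k l, ?_⟩
  ext1 r k
  rw [Matrix.map_apply, FiniteField.coe_frobeniusAlgHom, Matrix.mul_apply]
  exact hc k r

omit [Fintype F] in
theorem eq_top_of_X_mem {K : IntermediateField F (RatField F m n)}
    {L : IntermediateField K (RatField F m n)}
    (h : ∀ p, algebraMap (PolyRing F m n) (RatField F m n) (X p) ∈ L) : L = ⊤ := by
  have hp : ∀ f : PolyRing F m n, algebraMap (PolyRing F m n) (RatField F m n) f ∈ L := by
    intro f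
    induction f using MvPolynomial.induction_on with
    | C a =>
      have h1 : algebraMap (PolyRing F m n) (RatField F m n) (C a) =
          algebraMap K (RatField F m n) (algebraMap F K a) := by
        rw [← IsScalarTower.algebraMap_apply F K, ← algebraMap_eq,
          ← IsScalarTower.algebraMap_apply F (PolyRing F m n)]
      rw [h1]
      exact L.algebraMap_mem _
    | add f g hf hg => rw [map_add]; exact add_mem hf hg
    | mul_X f p hf => rw [map_mul]; exact mul_mem hf (h p)
  rw [eq_top_iff]
  intro x _
  obtain ⟨f, g, -, rfl⟩ := IsFractionRing.div_surjective (PolyRing F m n) x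
  exact div_mem (hp f) (hp g)

theorem adjoin_ratMatL0_eq_top (hm : 0 < m) :
    IntermediateField.adjoin (quotientField F n hm)
      (Set.range fun p : Fin n × Fin n => ratMatL0 F n hm p.1 p.2) = ⊤ := by
  refine eq_top_of_X_mem fun ⟨i, r⟩ => ?_
  obtain ⟨c, hc⟩ := exists_X_eq_sum (F := F) (n := n) hm i
  rw [hc r]
  exact sum_mem fun l _ => mul_mem (IntermediateField.subset_adjoin _ _ ⟨(r, l), rfl⟩)
    (IntermediateField.algebraMap_mem _ (c l))

omit [Fintype F] in
theorem ratAct_algebraMap {W : Type*} [AddCommGroup W] [Module F W] (b : Module.Basis (Fin n) F W)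
    (σ : W ≃ₗ[F] W) (f : PolyRing F m n) :
    ratAct b m σ (algebraMap (PolyRing F m n) (RatField F m n) f) =
      algebraMap (PolyRing F m n) (RatField F m n) (polyAct b m σ f) :=
  IsFractionRing.fieldEquivOfAlgEquiv_algebraMap _ _ _ _ _

omit [Fintype F] in
theorem exists_linearEquiv_toMatrix_inv_eq {W : Type*} [AddCommGroup W] [Module F W]
    (b : Module.Basis (Fin n) F W) {G : Matrix (Fin n) (Fin n) F} (hG : G.det ≠ 0) :
    ∃ σ : W ≃ₗ[F] W, LinearMap.toMatrix b b (σ⁻¹ : W ≃ₗ[F] W).toLinearMap = G := by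
  refine ⟨(Matrix.toLinearEquiv b G hG.isUnit)⁻¹, ?_⟩
  rw [inv_inv]
  exact LinearMap.toMatrix_toLin b b G

omit [Fintype F] in
theorem ratField_algHom_ext {Ω : Type*} [Field Ω] [Algebra F Ω] {τ ρ : RatField F m n →ₐ[F] Ω}
    (h : ∀ p, τ (algebraMap (PolyRing F m n) (RatField F m n) (X p)) =
      ρ (algebraMap (PolyRing F m n) (RatField F m n) (X p))) : τ = ρ := by
  refine IsLocalization.algHom_ext (nonZeroDivisors (PolyRing F m n)) ?_
  exact MvPolynomial.algHom_ext fun p => h p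

theorem ratAct_algebraMap_X {W : Type*} [AddCommGroup W] [Module F W]
    (b : Module.Basis (Fin n) F W) (σ : W ≃ₗ[F] W) (i : Fin m) (r : Fin n) :
    ratAct b m σ (algebraMap (PolyRing F m n) (RatField F m n) (X (i, r))) =
      ∑ s, LinearMap.toMatrix b b (σ⁻¹ : W ≃ₗ[F] W).toLinearMap r s •
        algebraMap (PolyRing F m n) (RatField F m n) (X (i, s)) := by
  have h := polyAct_vecPow b σ i 0 r
  simp only [vecPow, pow_zero, pow_one, ← smul_eq_C_mul] at h
  rw [ratAct_algebraMap, h, map_sum]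
  refine Finset.sum_congr rfl fun s _ => ?_
  rw [Algebra.smul_def, map_mul, ← IsScalarTower.algebraMap_apply, Algebra.smul_def]

/-- Every embedding over a field over which `B^(q) = B A` and the `X_i` are combinations of the
columns of `B` comes from the action of `GL(W)`. -/
theorem exists_ratAct_eq {K Ω : Type*} [Field K] [Algebra F K] [Algebra K (RatField F m n)]
    [IsScalarTower F K (RatField F m n)] [Field Ω] [Algebra F Ω] [Algebra K Ω]
    [IsScalarTower F K Ω] {W : Type*} [AddCommGroup W] [Module F W] (b : Module.Basis (Fin n) F W)
    {B : Matrix (Fin n) (Fin n) (RatField F m n)} {A : Matrix (Fin n) (Fin n) K} (hB : B.det ≠ 0)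
    (hA : B.map (FiniteField.frobeniusAlgHom F (RatField F m n)) =
      B * A.map (algebraMap K (RatField F m n)))
    (hX : ∀ i, ∃ c : Fin n → K, ∀ r,
      algebraMap (PolyRing F m n) (RatField F m n) (X (i, r)) =
        ∑ l, B r l * algebraMap K (RatField F m n) (c l))
    (ι τ : RatField F m n →ₐ[K] Ω) :
    ∃ σ : W ≃ₗ[F] W, ∀ x, τ x = ι (ratAct b m σ x) := by
  obtain ⟨G, hG, hτ⟩ := exists_map_eq_mul_of_frobenius_eq_mul hB hA ι τ
  obtain ⟨σ, hσ⟩ := exists_linearEquiv_toMatrix_inv_eq b hG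
  refine ⟨σ, fun x => ?_⟩
  have hτB : ∀ r l, τ (B r l) =
      ∑ s, G r s • ι (B s l) := fun r l => by
    have := congrFun (congrFun hτ r) l
    rw [Matrix.mul_apply] at this
    simp only [Algebra.smul_def]
    exact this
  -- The comparison is made over `F`, where agreement on the variables suffices.
  have h : τ.restrictScalars F = (ι.restrictScalars F).comp (ratAct b m σ).toAlgHom := by
    refine ratField_algHom_ext fun ⟨i, r⟩ => ?_
    obtain ⟨c, hc⟩ := hX i
    have hρ : ∀ (ρ : RatField F m n →ₐ[K] Ω) s,
        ρ (algebraMap (PolyRing F m n) (RatField F m n) (X (i, s))) =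
          ∑ l, ρ (B s l) * algebraMap (K) Ω (c l) := by
      intro ρ s
      rw [hc s, map_sum]
      refine Finset.sum_congr rfl fun l _ => ?_
      rw [map_mul]
      congr 1
      exact ρ.commutes (c l)
    have h1 : (ι.restrictScalars F) (ratAct b m σ
        (algebraMap (PolyRing F m n) (RatField F m n) (X (i, r)))) =
        ∑ s, G r s • ι (algebraMap (PolyRing F m n) (RatField F m n) (X (i, s))) := by
      rw [ratAct_algebraMap_X, hσ, map_sum]
      exact Finset.sum_congr rfl fun s _ => map_smul (ι.restrictScalars F) _ _
    refine Eq.trans ?_ h1.symm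
    refine (hρ τ r).trans ?_
    simp only [hρ ι, hτB, Finset.sum_mul, Finset.smul_sum]
    rw [Finset.sum_comm]
    simp only [smul_mul_assoc]
  exact DFunLike.congr_fun h x

/-! ### The two inclusions and the theorem -/

theorem quotientField_le_invariantField {W : Type*} [AddCommGroup W] [Module F W]
    (b : Module.Basis (Fin n) F W) (hm : 0 < m) :
    quotientField F n hm ≤ invariantField b m ⊤ := by
  rw [quotientField, IntermediateField.adjoin_le_iff]
  rintro _ ⟨⟨i, j⟩, rfl⟩
  rintro ⟨_, σ, -, rfl⟩
  change ratAct b m σ _ = _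
  obtain ⟨a, e, h⟩ := exists_matL_eq_powMatrix (F := F) hm i j
  have hd : LinearMap.det (σ⁻¹ : W ≃ₗ[F] W).toLinearMap ≠ 0 :=
    (LinearEquiv.isUnit_det' (σ⁻¹ : W ≃ₗ[F] W)).ne_zero
  simp only [map_div₀, ratAct_algebraMap, ell, ell0, h, matL0_eq_powMatrix, polyAct_det_powMatrix,
    map_mul]
  -- Numerator and denominator both acquire the factor `det σ⁻¹`, which cancels.
  refine mul_div_mul_left _ _ ?_
  simpa using hd

theorem invariantField_le_quotientField {W : Type*} [AddCommGroup W] [Module F W]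
    (b : Module.Basis (Fin n) F W) (hm : 0 < m) :
    invariantField b m ⊤ ≤ quotientField F n hm := by
  intro x hx
  have : Algebra.EssFiniteType F (RatField F m n) :=
    have : Algebra.EssFiniteType (PolyRing F m n) (RatField F m n) :=
      Algebra.EssFiniteType.of_isLocalization _ (nonZeroDivisors (PolyRing F m n))
    Algebra.EssFiniteType.comp F (PolyRing F m n) (RatField F m n)
  have : Algebra.EssFiniteType (quotientField F n hm) (RatField F m n) :=
    Algebra.EssFiniteType.of_comp F _ _
  obtain ⟨A, hA⟩ := exists_frobenius_ratMatL0_eq_mul (F := F) (n := n) hm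
  have : Algebra.IsSeparable (quotientField F n hm) (RatField F m n) :=
    isSeparable_of_frobenius_eq_mul (det_ratMatL0_ne_zero hm) hA (adjoin_ratMatL0_eq_top hm)
  let ι := IsScalarTower.toAlgHom (quotientField F n hm) (RatField F m n)
    (AlgebraicClosure (RatField F m n))
  obtain ⟨y, rfl⟩ := mem_range_algebraMap_of_algHom_eq _ ι (x := x) fun τ => by
    obtain ⟨σ, hσ⟩ := exists_ratAct_eq b (det_ratMatL0_ne_zero hm) hA
      (exists_X_eq_sum hm) ι τ
    rw [hσ x]
    exact congrArg ι (hx ⟨ratAct b m σ, σ, Subgroup.mem_top σ, rfl⟩)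
  exact y.2

end Generation

end VectorInvariants

theorem theorem1p1 {F : Type*} [Field F] [Fintype F] {W : Type*} [AddCommGroup W] [Module F W]
    {m n : ℕ} (hm : 0 < m) (b : Module.Basis (Fin n) F W) :
    -- the polynomials are homogeneous and `SL(W)`-invariant, and the denominator is nonzero
    VectorInvariants.ell0 F n hm ≠ 0 ∧
    (∃ d : ℕ, (VectorInvariants.ell0 F n hm).IsHomogeneous d) ∧
    (∀ (i : Fin m) (j : Fin n), ∃ d : ℕ, (VectorInvariants.ell F n hm i j).IsHomogeneous d) ∧
    VectorInvariants.ell0 F n hm ∈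
      VectorInvariants.invariantRing b m (VectorInvariants.specialLinear F W) ∧
    (∀ (i : Fin m) (j : Fin n), VectorInvariants.ell F n hm i j ∈
      VectorInvariants.invariantRing b m (VectorInvariants.specialLinear F W)) ∧
    -- the quotients generate the field of `GL(W)`-invariants
    VectorInvariants.invariantField b m ⊤ =
      IntermediateField.adjoin F (Set.range fun p : Fin m × Fin n =>
        algebraMap (VectorInvariants.PolyRing F m n) (VectorInvariants.RatField F m n)
            (VectorInvariants.ell F n hm p.1 p.2) /
          algebraMap (VectorInvariants.PolyRing F m n) (VectorInvariants.RatField F m n)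
            (VectorInvariants.ell0 F n hm)) := by
  open VectorInvariants in
  refine ⟨ell0_ne_zero hm, ?_, fun i j => ?_, ?_, fun i j => ?_,
    le_antisymm (invariantField_le_quotientField b hm) (quotientField_le_invariantField b hm)⟩
  · rw [ell0, matL0_eq_powMatrix]
    exact ⟨_, det_powMatrix_isHomogeneous _ _⟩
  · obtain ⟨a, e, h⟩ := exists_matL_eq_powMatrix (F := F) hm i j
    rw [ell, h]
    exact ⟨_, det_powMatrix_isHomogeneous _ _⟩
  · rw [ell0, matL0_eq_powMatrix]
    exact det_powMatrix_mem_invariantRing b _ _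
  · obtain ⟨a, e, h⟩ := exists_matL_eq_powMatrix (F := F) hm i j
    rw [ell, h]
    exact det_powMatrix_mem_invariantRing b _ _
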